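/- A differential space is a pair $(M,\mathscr F)$ of a topological space $M$ and a nonempty set $\mathscr F$ of functions $M\to\mathbb R$ such that: the topology of $M$ is the smallest one making all $f\in\mathscr F$ continuous; $g\circ(f_1,\dots,f_m)\in\mathscr F$ for all $m\ge 0$, $g\in C^\infty(\mathbb R^m)$ and $f_1,\dots,f_m\in\mathscr F$; and any function $M\to\mathbb R$ that agrees near each point with some element of $\mathscr F$ is in $\mathscr F$. A map $\varphi\colon(M,\mathscr F)\to(N,\mathscr G)$ is smooth if $f\circ\varphi\in\mathscr F$ for all $f\in\mathscr G$. A subset of a differential space carries the subspace structure, i.e. the smallest differential structure containing the restrictions of the given functions. An embedding is an injective smooth map that is a diffeomorphism (smooth with smooth inverse) onto its image with the subspace structure. The space $(M,\mathscr F)$ is subcartesian if every $p\in M$ has an open neighbourhood, with the subspace structure, that embeds in some $(\mathbb R^n,C^\infty(\mathbb R^n))$; the least such $n$ is the structural dimension at $p$, and the structural dimension of $M$ is the supremum of these over $p\in M$. A derivation of $\mathscr F$ is an $\mathbb R$-linear map $v\colon\mathscr F\to\mathscr F$ with $v(fg)=v(f)g+fv(g)$. An integral curve of $v$ is a map $\gamma\colon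 J\to M$, where $J\subseteq\mathbb R$ is a connected set containing $0$, such that either $J=\{0\}$, or $\gamma$ is smooth (with $J$ carrying the subspace structure from $\mathbb R$) and $\frac{d}{dx}(f\circ\gamma)=v(f)\circ\gamma$ on $J$ for all $f\in\mathscr F$. It is maximal if for every integral curve $\tau\colon K\to M$ of $v$ with $\tau(0)=\gamma(0)$ we have $K\subseteq J$ and $\gamma|_K=\tau$. **Corollary.** Let $(M,\mathscr F)$ be a second countable subcartesian differential space of finite structural dimension. Then for every derivation $v\colon\mathscr F\to\mathscr F$ and every point $p\in M$ there is a unique maximal integral curve $\gamma_p$ of $v$ with $\gamma_p(0)=p$. -/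

import Mathlib

open scoped ContDiff

namespace DiffSpace

/-- The smallest topology on `M` making every function in `F` continuous. -/
@[reducible]
def initialTopology {M : Type*} (F : Set (M → ℝ)) : TopologicalSpace M :=
  ⨅ f ∈ F, TopologicalSpace.induced f inferInstance

/-- `F` is a differential structure (in the sense of Sikorski) on the topological space `M`,
i.e. `(M, F)` is a differential space. -/
structure IsDifferentialStructure {M : Type*} [t : TopologicalSpace M] (F : Set (M → ℝ)) :
    Prop where
  nonempty : F.Nonempty
  topology_eq : t = initialTopology F
  comp_mem : ∀ (m : ℕ) (g : (Fin m → ℝ) → ℝ), ContDiff ℝ ∞ g →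
    ∀ f : Fin m → M → ℝ, (∀ i, f i ∈ F) → (fun x => g (fun i => f i x)) ∈ F
  mem_of_locally : ∀ g : M → ℝ,
    (∀ p : M, ∃ U ∈ nhds p, ∃ a ∈ F, Set.EqOn g a U) → g ∈ F

/-- A differential structure, as an algebra of functions under pointwise operations. -/
def IsDifferentialStructure.subalgebra {M : Type*} [TopologicalSpace M] {F : Set (M → ℝ)}
    (hF : IsDifferentialStructure F) : Subalgebra ℝ (M → ℝ) where
  carrier := F
  mul_mem' := by
    intro a b ha hb
    have h := hF.comp_mem 2 (fun y => y 0 * y 1) (by fun_prop) ![a, b]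
      (by intro i; fin_cases i <;> assumption)
    exact h
  add_mem' := by
    intro a b ha hb
    have h := hF.comp_mem 2 (fun y => y 0 + y 1) (by fun_prop) ![a, b]
      (by intro i; fin_cases i <;> assumption)
    exact h
  algebraMap_mem' := by
    intro r
    have h := hF.comp_mem 0 (fun _ => r) contDiff_const Fin.elim0 (fun i => i.elim0)
    exact h

/-- The differential structure on the set `N` generated by a set `A` of functions, i.e. the
smallest one containing `A`: the intersection of all differential structures on `N` that
contain `A`, each taken with its own initial topology. -/
def generated {N : Type*} (A : Set (N → ℝ)) : Set (N → ℝ) :=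
  {f | ∀ G : Set (N → ℝ), @IsDifferentialStructure N (initialTopology G) G → A ⊆ G → f ∈ G}

/-- The subspace differential structure on a subset `N` of `(M, F)`, generated by the
restrictions to `N` of the functions in `F`. -/
def subspaceStructure {M : Type*} (F : Set (M → ℝ)) (N : Set M) : Set (N → ℝ) :=
  generated {g | ∃ f ∈ F, g = fun x : N => f x}

/-- A smooth map of differential spaces. -/
def IsSmoothMap {M N : Type*} (F : Set (M → ℝ)) (G : Set (N → ℝ)) (φ : M → N) : Prop :=
  ∀ f ∈ G, f ∘ φ ∈ F

/-- A diffeomorphism of differential spaces. -/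
def IsDiffeo {M N : Type*} (F : Set (M → ℝ)) (G : Set (N → ℝ)) (φ : M → N) : Prop :=
  IsSmoothMap F G φ ∧
    ∃ ψ : N → M, Function.LeftInverse ψ φ ∧ Function.RightInverse ψ φ ∧ IsSmoothMap G F ψ

/-- An embedding of differential spaces: a smooth injective map that is a diffeomorphism onto
its image with the subspace differential structure. -/
def IsEmbedding {M N : Type*} (F : Set (M → ℝ)) (G : Set (N → ℝ)) (φ : M → N) : Prop :=
  IsSmoothMap F G φ ∧ Function.Injective φ ∧
    IsDiffeo F (subspaceStructure G (Set.range φ)) (Set.rangeFactorization φ)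

/-- The standard differential structure of a (finite dimensional) normed space. -/
def smoothFunctions (E : Type*) [NormedAddCommGroup E] [NormedSpace ℝ E] : Set (E → ℝ) :=
  {g | ContDiff ℝ ∞ g}

/-- Some open neighbourhood of `p`, with the subspace differential structure, embeds in `ℝⁿ`. -/
def EmbedsNear {M : Type*} [TopologicalSpace M] (F : Set (M → ℝ)) (p : M) (n : ℕ) : Prop :=
  ∃ U : Set M, IsOpen U ∧ p ∈ U ∧ ∃ φ : U → EuclideanSpace ℝ (Fin n),
    IsEmbedding (subspaceStructure F U) (smoothFunctions (EuclideanSpace ℝ (Fin n))) φ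

/-- A subcartesian space: every point has an open neighbourhood that embeds in some `ℝⁿ`. -/
def IsSubcartesian {M : Type*} [TopologicalSpace M] (F : Set (M → ℝ)) : Prop :=
  ∀ p : M, ∃ n : ℕ, EmbedsNear F p n

/-- The structural dimension at `p`: the smallest `n` such that a neighbourhood of `p` embeds
in `ℝⁿ` (`⊤` if there is none). -/
noncomputable def structuralDimAt {M : Type*} [TopologicalSpace M] (F : Set (M → ℝ)) (p : M) :
    ℕ∞ :=
  ⨅ (n : ℕ) (_ : EmbedsNear F p n), (n : ℕ∞)

/-- The structural dimension: the supremum of the structural dimensions at the points. -/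
noncomputable def structuralDim {M : Type*} [TopologicalSpace M] (F : Set (M → ℝ)) : ℕ∞ :=
  ⨆ p : M, structuralDimAt F p

/-- A map to `M` from an interval (a connected subset of `ℝ`, possibly a single point, not
necessarily open) containing `0`. -/
structure Curve (M : Type*) where
  domain : Set ℝ
  isConnected : IsConnected domain
  zero_mem : (0 : ℝ) ∈ domain
  toFun : domain → M

/-- The starting point `c 0` of a curve. -/
def Curve.start {M : Type*} (c : Curve M) : M := c.toFun ⟨0, c.zero_mem⟩

/-- `g'` is the derivative of `g : J → ℝ`. The values of the extension of `g` outside `J` play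
no role. -/
def IsDerivOn (J : Set ℝ) (g g' : J → ℝ) : Prop :=
  ∀ t : J, HasDerivWithinAt (Function.extend Subtype.val g 0) (g' t) J t

/-- Integral curves of a derivation `v`: any map from a one-point interval, or a smooth map `c`
from an interval with `(f ∘ c)' = v f ∘ c` for every function `f` of the structure. -/
def IsIntegralCurve {M : Type*} [TopologicalSpace M] {F : Set (M → ℝ)}
    {hF : IsDifferentialStructure F} (v : Derivation ℝ hF.subalgebra hF.subalgebra)
    (c : Curve M) : Prop :=
  c.domain = {0} ∨
    (IsSmoothMap (subspaceStructure (smoothFunctions ℝ) c.domain) F c.toFun ∧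
      ∀ f : hF.subalgebra,
        IsDerivOn c.domain ((f : M → ℝ) ∘ c.toFun) ((v f : M → ℝ) ∘ c.toFun))

/-- An integral curve that extends every integral curve with the same starting point. -/
def IsMaximalIntegralCurve {M : Type*} [TopologicalSpace M] {F : Set (M → ℝ)}
    {hF : IsDifferentialStructure F} (v : Derivation ℝ hF.subalgebra hF.subalgebra)
    (c : Curve M) : Prop :=
  IsIntegralCurve v c ∧ ∀ τ : Curve M, IsIntegralCurve v τ → τ.start = c.start →
    ∃ h : τ.domain ⊆ c.domain, ∀ t : τ.domain, c.toFun (Set.inclusion h t) = τ.toFun t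

end DiffSpace

/-!
Near each point a subcartesian space sits in some `ℝⁿ`, and a derivation `v` takes each coordinate
to a smooth function of the coordinates: `v` is locally the restriction of a smooth vector field
`X` on `ℝⁿ`, and its integral curves solve `x' = X(x)`. By uniqueness for this equation and
connectedness, two integral curves with the same start agree on their common domain, so the union
of all integral curves from `p` is a curve; it is the maximal one. Its domain may contain its
endpoints, and there a curve is smooth because it extends to the solution of `x' = X(x)` in `ℝⁿ`,
which may leave the space.
-/

open Set Filter Topology

namespace DiffSpace

section DifferentialStructure

variable {M N : Type*} {F : Set (M → ℝ)} {G : Set (N → ℝ)}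

theorem continuous_initialTopology {f : M → ℝ} (hf : f ∈ F) :
    Continuous[initialTopology F, inferInstance] f :=
  continuous_iff_le_induced.2 (iInf₂_le f hf)

theorem restrict_mem_subspaceStructure {f : M → ℝ} (hf : f ∈ F) (A : Set M) :
    (fun x : A => f x) ∈ subspaceStructure F A :=
  fun _ _ hA => hA ⟨f, hf, rfl⟩

theorem nhds_initialTopology (F : Set (M → ℝ)) (p : M) :
    @nhds M (initialTopology F) p = ⨅ f ∈ F, comap f (𝓝 (f p)) := by
  simp only [nhds_iInf, nhds_induced]

variable [TopologicalSpace M]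

namespace IsDifferentialStructure

theorem continuous (hF : IsDifferentialStructure F) {f : M → ℝ} (hf : f ∈ F) : Continuous f :=
  continuous_iff_le_induced.2 (hF.topology_eq.le.trans (iInf₂_le f hf))

theorem tendsto_nhds_iff (hF : IsDifferentialStructure F) {α : Type*} {u : α → M} {l : Filter α}
    {p : M} : Tendsto u l (𝓝 p) ↔ ∀ f ∈ F, Tendsto (f ∘ u) l (𝓝 (f p)) := by
  have hnhds : 𝓝 p = ⨅ f ∈ F, comap f (𝓝 (f p)) := by
    rw [← nhds_initialTopology, ← hF.topology_eq]
  simp only [hnhds, tendsto_iInf, tendsto_comap_iff]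

theorem continuous_iff (hF : IsDifferentialStructure F) {X : Type*} [TopologicalSpace X]
    {φ : X → M} : Continuous φ ↔ ∀ f ∈ F, Continuous (f ∘ φ) := by
  simp only [continuous_iff_continuousAt, ContinuousAt, hF.tendsto_nhds_iff]
  exact ⟨fun h f hf x => h x f hf, fun h x f hf => h f hf x⟩

theorem t2Space (hF : IsDifferentialStructure F) (hsep : F.SeparatesPoints) : T2Space M :=
  ⟨fun _ _ hxy =>
    let ⟨_, hf, hne⟩ := hsep hxy
    separated_by_continuous (hF.continuous hf) hne⟩

theorem initialTopology_le_subtype (hF : IsDifferentialStructure F) {A : Set M}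
    {H : Set (A → ℝ)} (hH : ∀ f ∈ F, (fun x : A => f x) ∈ H) :
    initialTopology H ≤ instTopologicalSpaceSubtype := by
  let _ : TopologicalSpace A := initialTopology H
  exact continuous_iff_le_induced.1
    (hF.continuous_iff.2 fun f hf => continuous_initialTopology (hH f hf))

end IsDifferentialStructure

/-- The functions on a subset `A` that near each point of `A` are restrictions of functions of
`F`. This is the concrete description of the subspace structure. -/
def localRestrictions (F : Set (M → ℝ)) (A : Set M) : Set (A → ℝ) :=
  {g | ∀ x : A, ∃ f ∈ F, g =ᶠ[𝓝 x] fun y => f y}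

theorem restrict_mem_localRestrictions {f : M → ℝ} (hf : f ∈ F) (A : Set M) :
    (fun x : A => f x) ∈ localRestrictions F A :=
  fun _ => ⟨f, hf, .rfl⟩

theorem IsDifferentialStructure.localRestrictions (hF : IsDifferentialStructure F) (A : Set M) :
    IsDifferentialStructure (localRestrictions F A) where
  nonempty := hF.nonempty.imp' (fun f x => f x) fun _ hf => restrict_mem_localRestrictions hf A
  topology_eq := by
    refine le_antisymm (le_iInf₂ fun g hg => ?_)
      (hF.initialTopology_le_subtype fun f hf => restrict_mem_localRestrictions hf A)
    refine continuous_iff_le_induced.1 (continuous_iff_continuousAt.2 fun x => ?_)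
    obtain ⟨f, hf, hgf⟩ := hg x
    exact ((hF.continuous hf).comp continuous_subtype_val).continuousAt.congr hgf.symm
  comp_mem m g hg f hf x := by
    choose a ha hfa using fun i => hf i x
    refine ⟨_, hF.comp_mem m g hg a ha, ?_⟩
    filter_upwards [eventually_all.2 hfa] with y hy
    simp only [hy]
  mem_of_locally g hg x := by
    obtain ⟨U, hU, a, ha, hga⟩ := hg x
    obtain ⟨f, hf, haf⟩ := ha x
    exact ⟨f, hf, (hga.eventuallyEq_of_mem hU).trans haf⟩

theorem IsDifferentialStructure.subspaceStructure_eq (hF : IsDifferentialStructure F)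
    (A : Set M) : subspaceStructure F A = DiffSpace.localRestrictions F A := by
  have hloc := hF.localRestrictions A
  refine Subset.antisymm (fun g hg => hg _ (by rwa [← hloc.topology_eq]) ?_)
    fun g hg H hH hsub => ?_
  · rintro _ ⟨f, hf, rfl⟩
    exact restrict_mem_localRestrictions hf A
  · have hle : initialTopology H ≤ instTopologicalSpaceSubtype :=
      hF.initialTopology_le_subtype fun f hf => hsub ⟨f, hf, rfl⟩
    refine @IsDifferentialStructure.mem_of_locally A (initialTopology H) H hH g fun x => ?_
    obtain ⟨f, hf, hgf⟩ := hg x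
    exact ⟨_, nhds_mono hle hgf, _, hsub ⟨f, hf, rfl⟩, fun _ hy => hy⟩

theorem IsDifferentialStructure.subspaceStructure (hF : IsDifferentialStructure F) (A : Set M) :
    IsDifferentialStructure (subspaceStructure F A) := by
  rw [hF.subspaceStructure_eq]
  exact hF.localRestrictions A

theorem IsSmoothMap.continuous [TopologicalSpace N] (hF : IsDifferentialStructure F)
    (hG : IsDifferentialStructure G) {φ : M → N} (hφ : IsSmoothMap F G φ) : Continuous φ :=
  hG.continuous_iff.2 fun f hf => hF.continuous (hφ f hf)

theorem isDifferentialStructure_smoothFunctions (E : Type*) [NormedAddCommGroup E]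
    [NormedSpace ℝ E] [HasContDiffBump E] : IsDifferentialStructure (smoothFunctions E) where
  nonempty := ⟨fun _ => 0, contDiff_const (𝕜 := ℝ) (n := ∞)⟩
  topology_eq := by
    refine le_antisymm (le_iInf₂ fun f hf => (ContDiff.continuous (n := ∞) hf).le_induced)
      (le_of_nhds_le_nhds fun x s hs => ?_)
    obtain ⟨ε, hε, hεs⟩ := Metric.mem_nhds_iff.1 hs
    let b : ContDiffBump x := ⟨ε / 2, ε, half_pos hε, half_lt_self hε⟩
    have hball : Metric.ball x ε = b ⁻¹' {0}ᶜ := b.support_eq.symm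
    have hbx : b x ∈ ({0}ᶜ : Set ℝ) := (b.pos_of_mem_ball (Metric.mem_ball_self hε)).ne'
    have hle : @nhds E (initialTopology (smoothFunctions E)) x ≤ comap b (𝓝 (b x)) := by
      rw [nhds_initialTopology]
      exact iInf₂_le (b : E → ℝ) (b.contDiff (n := ⊤))
    exact hle <| mem_of_superset (preimage_mem_comap (isOpen_compl_singleton.mem_nhds hbx))
      (hball.ge.trans hεs)
  comp_mem _ _ hg _ hf := ContDiff.comp (n := ∞) hg (contDiff_pi.2 hf)
  mem_of_locally g hg := by
    refine (contDiff_iff_contDiffAt (𝕜 := ℝ) (n := ∞)).2 fun x => ?_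
    obtain ⟨U, hU, a, ha, hga⟩ := hg x
    exact (ContDiff.contDiffAt (n := ∞) ha).congr_of_eventuallyEq (hga.eventuallyEq_of_mem hU)

end DifferentialStructure

section LocalEmbedding

variable {M E : Type*} [TopologicalSpace M] [NormedAddCommGroup E] [NormedSpace ℝ E]
  {F : Set (M → ℝ)} {p : M} {n : ℕ}

/-- Local coordinates near `p`: a globally defined smooth map to a normed space that is injective
near `p` and through which every function of the structure factors smoothly near `p`. Having the
map defined on all of `M` allows a derivation to be applied to its components. -/
structure IsLocalEmbeddingAt (F : Set (M → ℝ)) (p : M) (φ : M → E) : Prop where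
  smooth : IsSmoothMap F (smoothFunctions E) φ
  exists_injOn : ∃ W ∈ 𝓝 p, InjOn φ W
  exists_eventuallyEq_comp : ∀ f ∈ F, ∃ g : E → ℝ, ContDiff ℝ ∞ g ∧ f =ᶠ[𝓝 p] g ∘ φ

theorem isSmoothMap_euclideanSpace_iff (hF : IsDifferentialStructure F)
    {φ : M → EuclideanSpace ℝ (Fin n)} :
    IsSmoothMap F (smoothFunctions (EuclideanSpace ℝ (Fin n))) φ ↔ ∀ i, (fun x => φ x i) ∈ F := by
  refine ⟨fun h i => h (fun y => y i) (show ContDiff ℝ ∞ _ by fun_prop), fun h g hg => ?_⟩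
  exact hF.comp_mem n (g ∘ WithLp.toLp 2) (ContDiff.comp (n := ∞) hg PiLp.contDiff_toLp) _ h

theorem IsSmoothMap.exists_eventuallyEq_restrict (hF : IsDifferentialStructure F) {A : Set M}
    {Φ : A → EuclideanSpace ℝ (Fin n)}
    (hΦ : IsSmoothMap (subspaceStructure F A) (smoothFunctions (EuclideanSpace ℝ (Fin n))) Φ)
    (x : A) :
    ∃ φ : M → EuclideanSpace ℝ (Fin n),
      IsSmoothMap F (smoothFunctions (EuclideanSpace ℝ (Fin n))) φ ∧
        Φ =ᶠ[𝓝 x] fun y => φ y := by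
  have hcoord := (isSmoothMap_euclideanSpace_iff (hF.subspaceStructure A)).1 hΦ
  simp only [hF.subspaceStructure_eq] at hcoord
  choose φ hφF hφ using fun i => hcoord i x
  refine ⟨fun y => WithLp.toLp 2 fun i => φ i y, (isSmoothMap_euclideanSpace_iff hF).2 hφF, ?_⟩
  filter_upwards [eventually_all.2 hφ] with y hy
  exact PiLp.ext hy

theorem EmbedsNear.exists_isLocalEmbeddingAt (hF : IsDifferentialStructure F)
    (h : EmbedsNear F p n) :
    ∃ φ : M → EuclideanSpace ℝ (Fin n), IsLocalEmbeddingAt F p φ := by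
  obtain ⟨U, hU, hpU, Φ, hΦ, hΦinj, -, ψ, hψ, -, hψs⟩ := h
  obtain ⟨φ, hφ, hΦφ⟩ := hΦ.exists_eventuallyEq_restrict hF ⟨p, hpU⟩
  have hE := isDifferentialStructure_smoothFunctions (EuclideanSpace ℝ (Fin n))
  have hnhds : map (Subtype.val : U → M) (𝓝 ⟨p, hpU⟩) = 𝓝 p :=
    map_nhds_subtype_coe_eq_nhds hpU (hU.mem_nhds hpU)
  refine ⟨φ, hφ, ⟨_, hnhds ▸ image_mem_map hΦφ, ?_⟩, fun f hf => ?_⟩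
  · rintro _ ⟨x, hx, rfl⟩ _ ⟨y, hy, rfl⟩ hxy
    rw [hΦinj (hx.trans (hxy.trans hy.symm))]
  · have hfψ := hψs _ (restrict_mem_subspaceStructure hf U)
    rw [hE.subspaceStructure_eq] at hfψ
    obtain ⟨g, hg, hfg⟩ := hfψ (rangeFactorization Φ ⟨p, hpU⟩)
    have hΦc : Continuous (rangeFactorization Φ) :=
      (hΦ.continuous (hF.subspaceStructure U) hE).subtype_mk _
    refine ⟨g, hg, ?_⟩
    rw [← hnhds, EventuallyEq, eventually_map]
    filter_upwards [hΦc.continuousAt.eventually hfg, hΦφ] with x hx hxφ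
    calc f x = f (ψ (rangeFactorization Φ x)) := by rw [hψ x]
      _ = g (Φ x) := hx
      _ = g (φ x) := congrArg g hxφ

theorem IsSubcartesian.separatesPoints (hF : IsDifferentialStructure F)
    (hsub : IsSubcartesian F) : F.SeparatesPoints := by
  intro x y hxy
  by_contra! hcon
  obtain ⟨n, hn⟩ := hsub y
  obtain ⟨φ, hφ⟩ := hn.exists_isLocalEmbeddingAt hF
  obtain ⟨W, hW, hinj⟩ := hφ.exists_injOn
  have hpure : Tendsto id (pure x) (𝓝 y) :=
    hF.tendsto_nhds_iff.2 fun f hf => hcon f hf ▸ tendsto_pure_nhds f x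
  refine hxy (hinj (hpure hW) (mem_of_mem_nhds hW) (PiLp.ext fun i => ?_))
  exact hcon _ ((isSmoothMap_euclideanSpace_iff hF).1 hφ.smooth i)

end LocalEmbedding

section ODE

variable {E : Type*} [NormedAddCommGroup E] [NormedSpace ℝ E]

theorem eqOn_of_isIntegralCurveOn_of_lipschitzOnWith {X : ℝ → E → E} {s : ℝ → Set E}
    {K : NNReal} {u w : ℝ → E} {J : Set ℝ} {t₀ : ℝ} (hJ : J.OrdConnected)
    (hX : ∀ t ∈ J, LipschitzOnWith K (X t) (s t)) (hu : IsIntegralCurveOn u X J)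
    (hus : ∀ t ∈ J, u t ∈ s t) (hw : IsIntegralCurveOn w X J) (hws : ∀ t ∈ J, w t ∈ s t)
    (ht₀ : t₀ ∈ J) (h : u t₀ = w t₀) : EqOn u w J := by
  intro t ht
  rcases le_total t₀ t with hle | hle
  · have hI : Icc t₀ t ⊆ J := hJ.out ht₀ ht
    have hI' : Ico t₀ t ⊆ J := Ico_subset_Icc_self.trans hI
    have hright : ∀ a ∈ Ico t₀ t, J ∈ 𝓝[≥] a := fun a ha =>
      mem_of_superset (Icc_mem_nhdsGE ha.2) (hJ.out (hI' ha) ht)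
    exact ODE_solution_unique_of_mem_Icc_right (fun a ha => hX a (hI' ha))
      (hu.mono hI).continuousOn
      (fun a ha => (hu a (hI' ha)).mono_of_mem_nhdsWithin (hright a ha))
      (fun a ha => hus a (hI' ha)) (hw.mono hI).continuousOn
      (fun a ha => (hw a (hI' ha)).mono_of_mem_nhdsWithin (hright a ha))
      (fun a ha => hws a (hI' ha)) h (right_mem_Icc.2 hle)
  · have hI : Icc t t₀ ⊆ J := hJ.out ht ht₀
    have hI' : Ioc t t₀ ⊆ J := Ioc_subset_Icc_self.trans hI
    have hleft : ∀ a ∈ Ioc t t₀, J ∈ 𝓝[≤] a := fun a ha =>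
      mem_of_superset (Icc_mem_nhdsLE ha.1) (hJ.out ht (hI' ha))
    exact ODE_solution_unique_of_mem_Icc_left (fun a ha => hX a (hI' ha))
      (hu.mono hI).continuousOn
      (fun a ha => (hu a (hI' ha)).mono_of_mem_nhdsWithin (hleft a ha))
      (fun a ha => hus a (hI' ha)) (hw.mono hI).continuousOn
      (fun a ha => (hw a (hI' ha)).mono_of_mem_nhdsWithin (hleft a ha))
      (fun a ha => hws a (hI' ha)) h (left_mem_Icc.2 hle)

theorem eventuallyEq_nhdsWithin_of_hasDerivWithinAt {X : E → E} {u w : ℝ → E} {J : Set ℝ} {t₀ : ℝ}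
    (hJ : J.OrdConnected) (ht₀ : t₀ ∈ J) (hX : ContDiffAt ℝ 1 X (u t₀))
    (hu : ∀ᶠ t in 𝓝[J] t₀, HasDerivWithinAt u (X (u t)) J t)
    (hw : ∀ᶠ t in 𝓝[J] t₀, HasDerivWithinAt w (X (w t)) J t) (h : u t₀ = w t₀) :
    u =ᶠ[𝓝[J] t₀] w := by
  obtain ⟨K, s, hs, hK⟩ := hX.exists_lipschitzOnWith
  have hus := (hu.self_of_nhdsWithin ht₀).continuousWithinAt.eventually hs
  have hws := (hw.self_of_nhdsWithin ht₀).continuousWithinAt.eventually (h ▸ hs)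
  obtain ⟨δ, hδ, hball⟩ := Metric.mem_nhdsWithin_iff.1 ((hu.and hus).and (hw.and hws))
  have hsub : Metric.ball t₀ δ ∩ J ⊆ J := inter_subset_right
  exact Metric.mem_nhdsWithin_iff.2 ⟨δ, hδ, eqOn_of_isIntegralCurveOn_of_lipschitzOnWith
    (X := fun _ => X) (s := fun _ => s)
    ((convex_ball t₀ δ).ordConnected.inter hJ) (fun _ _ => hK)
    (fun t ht => (hball ht).1.1.mono hsub) (fun t ht => (hball ht).1.2)
    (fun t ht => (hball ht).2.1.mono hsub) (fun t ht => (hball ht).2.2)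
    ⟨Metric.mem_ball_self hδ, ht₀⟩ h⟩

theorem exists_contDiff_eventuallyEq {E' : Type*} [NormedAddCommGroup E'] [NormedSpace ℝ E']
    [HasContDiffBump E] {n : ℕ∞} {g : E → E'} {x : E} (hg : ∀ᶠ y in 𝓝 x, ContDiffAt ℝ n g y) :
    ∃ h : E → E', ContDiff ℝ n h ∧ h =ᶠ[𝓝 x] g := by
  obtain ⟨ε, hε, hball⟩ := Metric.eventually_nhds_iff_ball.1 hg
  let b : ContDiffBump x := ⟨ε / 4, ε / 2, by positivity, by linarith⟩
  refine ⟨(b : E → ℝ) • g, contDiff_iff_contDiffAt.2 fun y => ?_, ?_⟩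
  · by_cases hy : y ∈ tsupport ((b : E → ℝ) • g)
    · have hyε : y ∈ Metric.closedBall x (ε / 2) := 
        b.tsupport_eq ▸ tsupport_smul_subset_left b g hy
      exact b.contDiffAt.smul (hball y (Metric.closedBall_subset_ball (half_lt_self hε) hyε))
    · exact contDiffAt_const.congr_of_eventuallyEq (notMem_tsupport_iff_eventuallyEq.1 hy)
  · filter_upwards [b.eventuallyEq_one] with y hy
    rw [Pi.smul_apply', hy, Pi.one_apply, one_smul]

theorem exists_contDiff_eventually_hasDerivAt [CompleteSpace E] {n : ℕ∞} (hn : 1 ≤ n) {X : E → E}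
    (hX : ContDiff ℝ n X) (t₀ : ℝ) (x₀ : E) :
    ∃ α : ℝ → E, ContDiff ℝ n α ∧ α t₀ = x₀ ∧ ∀ᶠ t in 𝓝 t₀, HasDerivAt α (X (α t)) t := by
  obtain ⟨β, hβ₀, ε, hε, hβ⟩ :=
    (hX.contDiffAt.of_le
      (mod_cast hn)).exists_forall_mem_closedBall_exists_eq_forall_mem_Ioo_hasDerivAt₀ t₀
  have hnear : ∀ᶠ t in 𝓝 t₀, t ∈ Ioo (t₀ - ε / 2) (t₀ + ε / 2) :=
    Ioo_mem_nhds (by linarith) (by linarith)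
  have hIcc : Icc (t₀ - ε / 2) (t₀ + ε / 2) ⊆ Ioo (t₀ - ε) (t₀ + ε) :=
    Icc_subset_Ioo (by linarith) (by linarith)
  have hsmooth : ContDiffOn ℝ n β (Icc (t₀ - ε / 2) (t₀ + ε / 2)) :=
    ODE.contDiffOn_enat_Icc_of_hasDerivWithinAt (f := fun _ => X) (u := univ)
      (hX.comp contDiff_snd).contDiffOn (fun t ht => (hβ t (hIcc ht)).hasDerivWithinAt)
      (mapsTo_univ _ _)
  obtain ⟨α, hα, hαβ⟩ := exists_contDiff_eventuallyEq
    (hnear.mono fun t ht => hsmooth.contDiffAt (Icc_mem_nhds ht.1 ht.2))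
  refine ⟨α, hα, hαβ.self_of_nhds.trans hβ₀, ?_⟩
  filter_upwards [hαβ.eventuallyEq_nhds, hnear] with t ht htI
  rw [ht.eq_of_nhds]
  exact (hβ t (hIcc (Ioo_subset_Icc_self htI))).congr_of_eventuallyEq ht

end ODE

section OrderTopology

variable {α ι : Type*} [LinearOrder α] [TopologicalSpace α] [OrderTopology α] {S : ι → Set α}
  {a t : α}

theorem exists_mem_nhdsWithin_iUnion_inter_Ici (hS : ∀ i, (S i).OrdConnected) (ha : ∀ i, a ∈ S i)
    (ht : t ∈ ⋃ i, S i) : ∃ i, t ∈ S i ∧ S i ∈ 𝓝[(⋃ i, S i) ∩ Ici t] t := by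
  obtain ⟨i, hi⟩ := mem_iUnion.1 ht
  have of_Icc : ∀ {j s}, t < s → Icc t s ⊆ S j → t ∈ S j ∧ S j ∈ 𝓝[(⋃ i, S i) ∩ Ici t] t :=
    fun {j s} hts hsub => ⟨hsub (left_mem_Icc.2 hts.le),
      nhdsWithin_mono t inter_subset_right (mem_of_superset (Icc_mem_nhdsGE hts) hsub)⟩
  rcases lt_or_ge t a with hta | hat
  · exact ⟨i, of_Icc hta ((hS i).out hi (ha i))⟩
  · by_cases hlast : ∃ s ∈ ⋃ i, S i, t < s
    · obtain ⟨s, hs, hts⟩ := hlast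
      obtain ⟨j, hj⟩ := mem_iUnion.1 hs
      exact ⟨j, of_Icc hts ((Icc_subset_Icc_left hat).trans ((hS j).out (ha j) hj))⟩
    · push Not at hlast
      refine ⟨i, hi, mem_of_superset self_mem_nhdsWithin fun s hs => ?_⟩
      rwa [le_antisymm (hlast s hs.1) hs.2]

theorem exists_mem_nhdsWithin_iUnion_inter_Iic (hS : ∀ i, (S i).OrdConnected) (ha : ∀ i, a ∈ S i)
    (ht : t ∈ ⋃ i, S i) : ∃ i, t ∈ S i ∧ S i ∈ 𝓝[(⋃ i, S i) ∩ Iic t] t :=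
  exists_mem_nhdsWithin_iUnion_inter_Ici (α := αᵒᵈ) (fun i => (hS i).dual) ha ht

end OrderTopology

section IntegralCurve

variable {M : Type*} [TopologicalSpace M] {F : Set (M → ℝ)} {hF : IsDifferentialStructure F}
  {v : Derivation ℝ hF.subalgebra hF.subalgebra} {γ τ : ℝ → M} {J K : Set ℝ} {t t₀ : ℝ}

/-- `γ` has velocity `v` at time `t`, seen from within `J`: the derivative condition for integral
curves at a single time. Curves are taken here as total maps on `ℝ`, so that one map can be
restricted to various domains; the values outside `J` and `t` do not matter. -/
def HasVelocityWithinAt (v : Derivation ℝ hF.subalgebra hF.subalgebra) (γ : ℝ → M) (J : Set ℝ)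
    (t : ℝ) : Prop :=
  ∀ f : hF.subalgebra, HasDerivWithinAt ((f : M → ℝ) ∘ γ) ((v f : M → ℝ) (γ t)) J t

/-- `γ` has velocity `v` at all times of `J`: the derivative condition for integral curves. -/
def HasVelocityOn (v : Derivation ℝ hF.subalgebra hF.subalgebra) (γ : ℝ → M) (J : Set ℝ) : Prop :=
  ∀ t ∈ J, HasVelocityWithinAt v γ J t

namespace HasVelocityWithinAt

theorem congr (h : HasVelocityWithinAt v γ J t) (hτ : EqOn τ γ J) (ht : t ∈ J) :
    HasVelocityWithinAt v τ J t := fun f => by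
  rw [hτ ht]
  exact (h f).congr_of_mem (fun s hs => congrArg (f : M → ℝ) (hτ hs)) ht

theorem mono_of_mem_nhdsWithin (h : HasVelocityWithinAt v γ J t) (hJ : J ∈ 𝓝[K] t) :
    HasVelocityWithinAt v γ K t :=
  fun f => (h f).mono_of_mem_nhdsWithin hJ

theorem union (hJ : HasVelocityWithinAt v γ J t) (hK : HasVelocityWithinAt v γ K t) :
    HasVelocityWithinAt v γ (J ∪ K) t :=
  fun f => (hJ f).union (hK f)

theorem continuousWithinAt (h : HasVelocityWithinAt v γ J t) : ContinuousWithinAt γ J t :=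
  hF.tendsto_nhds_iff.2 fun f hf => (h ⟨f, hf⟩).continuousWithinAt

end HasVelocityWithinAt

namespace HasVelocityOn

theorem mono (h : HasVelocityOn v γ J) (hK : K ⊆ J) : HasVelocityOn v γ K :=
  fun t ht => (h t (hK ht)).mono_of_mem_nhdsWithin (mem_of_superset self_mem_nhdsWithin hK)

theorem congr (h : HasVelocityOn v γ J) (hτ : EqOn τ γ J) : HasVelocityOn v τ J :=
  fun t ht => (h t ht).congr hτ ht

theorem continuousOn (h : HasVelocityOn v γ J) : ContinuousOn γ J :=
  fun t ht => (h t ht).continuousWithinAt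

theorem eventually (h : HasVelocityOn v γ J) (ht₀ : t₀ ∈ J) {P : M → Prop}
    (hP : ∀ᶠ x in 𝓝 (γ t₀), P x) : ∀ᶠ t in 𝓝[J] t₀, P (γ t) :=
  (h t₀ ht₀).continuousWithinAt.eventually hP

end HasVelocityOn

theorem IsLocalEmbeddingAt.exists_vectorField {n : ℕ} {p : M} {φ : M → EuclideanSpace ℝ (Fin n)}
    (hφ : IsLocalEmbeddingAt F p φ) (v : Derivation ℝ hF.subalgebra hF.subalgebra) :
    ∃ X : EuclideanSpace ℝ (Fin n) → EuclideanSpace ℝ (Fin n), ContDiff ℝ ∞ X ∧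
      ∀ {γ : ℝ → M} {J : Set ℝ} {t₀ : ℝ}, HasVelocityOn v γ J → t₀ ∈ J → γ t₀ = p →
        ∀ᶠ t in 𝓝[J] t₀, HasDerivWithinAt (φ ∘ γ) (X (φ (γ t))) J t := by
  have hmem := (isSmoothMap_euclideanSpace_iff hF).1 hφ.smooth
  choose X hX hvX using fun i =>
    hφ.exists_eventuallyEq_comp (v ⟨fun x => φ x i, hmem i⟩ : M → ℝ) (v _).2
  refine ⟨fun y => WithLp.toLp 2 fun i => X i y, contDiff_euclidean.2 hX,
    fun {γ J t₀} hγ ht₀ hp => ?_⟩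
  subst hp
  filter_upwards [hγ.eventually ht₀ (eventually_all.2 hvX), self_mem_nhdsWithin] with t ht htJ
  refine hasFDerivWithinAt_euclidean.2 fun i => ?_
  have hi := (hγ t htJ ⟨fun x => φ x i, hmem i⟩).hasFDerivWithinAt
  rw [ht i] at hi
  refine hi.congr_fderiv ?_
  ext
  simp

namespace HasVelocityOn

theorem eventuallyEq (hγ : HasVelocityOn v γ J) (hτ : HasVelocityOn v τ J)
    (hsub : IsSubcartesian F) (hJ : J.OrdConnected) (ht₀ : t₀ ∈ J) (h : γ t₀ = τ t₀) :
    γ =ᶠ[𝓝[J] t₀] τ := by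
  obtain ⟨n, hn⟩ := hsub (γ t₀)
  obtain ⟨φ, hφ⟩ := hn.exists_isLocalEmbeddingAt hF
  obtain ⟨X, hX, hvX⟩ := hφ.exists_vectorField v
  obtain ⟨W, hW, hinj⟩ := hφ.exists_injOn
  have hφeq : φ ∘ γ =ᶠ[𝓝[J] t₀] φ ∘ τ :=
    eventuallyEq_nhdsWithin_of_hasDerivWithinAt hJ ht₀ (hX.contDiffAt.of_le (by simp))
      (hvX hγ ht₀ rfl) (hvX hτ ht₀ h.symm) (congrArg φ h)
  filter_upwards [hφeq, hγ.eventually ht₀ hW, hτ.eventually ht₀ (h ▸ hW)] with t ht hγW hτW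
  exact hinj hγW hτW ht

theorem eqOn (hγ : HasVelocityOn v γ J) (hτ : HasVelocityOn v τ J) (hsub : IsSubcartesian F)
    (hJ : J.OrdConnected) (ht₀ : t₀ ∈ J) (h : γ t₀ = τ t₀) : EqOn γ τ J := by
  have : T2Space M := hF.t2Space (hsub.separatesPoints hF)
  have : PreconnectedSpace J := isPreconnected_iff_preconnectedSpace.1 hJ.isPreconnected
  let A : Set J := {t | γ t = τ t}
  have hclosed : IsClosed A :=
    isClosed_eq hγ.continuousOn.domRestrict hτ.continuousOn.domRestrict
  have hopen : IsOpen A := isOpen_iff_mem_nhds.2 fun t ht =>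
    (eventually_nhds_subtype_iff J t fun s => γ s = τ s).2 (hγ.eventuallyEq hτ hsub hJ t.2 ht)
  have huniv : A = univ := IsClopen.eq_univ ⟨hclosed, hopen⟩ ⟨⟨t₀, ht₀⟩, h⟩
  exact fun t ht => huniv.ge (mem_univ ⟨t, ht⟩)

theorem exists_contDiff_eventuallyEq (hγ : HasVelocityOn v γ J) (hsub : IsSubcartesian F)
    (hJ : J.OrdConnected) (ht₀ : t₀ ∈ J) {f : M → ℝ} (hf : f ∈ F) :
    ∃ h : ℝ → ℝ, ContDiff ℝ ∞ h ∧ f ∘ γ =ᶠ[𝓝[J] t₀] h := by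
  obtain ⟨n, hn⟩ := hsub (γ t₀)
  obtain ⟨φ, hφ⟩ := hn.exists_isLocalEmbeddingAt hF
  obtain ⟨X, hX, hvX⟩ := hφ.exists_vectorField v
  obtain ⟨α, hα, hα₀, hαX⟩ := exists_contDiff_eventually_hasDerivAt le_top hX t₀ (φ (γ t₀))
  obtain ⟨g, hg, hfg⟩ := hφ.exists_eventuallyEq_comp f hf
  have hφα : φ ∘ γ =ᶠ[𝓝[J] t₀] α :=
    eventuallyEq_nhdsWithin_of_hasDerivWithinAt hJ ht₀ (hX.contDiffAt.of_le (by simp))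
      (hvX hγ ht₀ rfl) (nhdsWithin_le_nhds (hαX.mono fun t ht => ht.hasDerivWithinAt)) hα₀.symm
  refine ⟨g ∘ α, hg.comp hα, ?_⟩
  filter_upwards [hφα, hγ.eventually ht₀ hfg] with t ht htf
  calc f (γ t) = g (φ (γ t)) := htf
    _ = g (α t) := congrArg g ht

end HasVelocityOn

namespace Curve

variable {M : Type*} {ι : Type*}

/-- The map `ℝ → M` that is constant outside the domain of `c`. -/
noncomputable def extend (c : Curve M) : ℝ → M :=
  Function.extend Subtype.val c.toFun fun _ => c.start

@[simp]
theorem extend_coe (c : Curve M) (t : c.domain) : c.extend t = c.toFun t :=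
  Subtype.val_injective.extend_apply _ _ t

theorem isDerivOn_iff_hasDerivWithinAt {f g : M → ℝ} (c : Curve M) :
    IsDerivOn c.domain (f ∘ c.toFun) (g ∘ c.toFun) ↔
      ∀ t ∈ c.domain, HasDerivWithinAt (f ∘ c.extend) (g (c.extend t)) c.domain t := by
  have heq : EqOn (Function.extend Subtype.val (f ∘ c.toFun) 0) (f ∘ c.extend) c.domain :=
    fun t ht => by
      lift t to c.domain using ht
      rw [Subtype.val_injective.extend_apply, Function.comp_apply, Function.comp_apply,
        c.extend_coe]
  refine Subtype.forall.trans (forall₂_congr fun t ht => ?_)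
  rw [c.extend_coe ⟨t, ht⟩]
  exact ⟨fun h => h.congr_of_mem heq.symm ht, fun h => h.congr_of_mem heq ht⟩

theorem ordConnected (c : Curve M) : c.domain.OrdConnected :=
  c.isConnected.isPreconnected.ordConnected

/-- The curve at `p` whose domain is a single point. -/
def point (p : M) : Curve M where
  domain := {0}
  isConnected := isConnected_singleton
  zero_mem := mem_singleton 0
  toFun _ := p

/-- The union of a family of curves. Where the curves agree on their common domains this is their
common extension; otherwise its values are picked arbitrarily from theirs. -/
noncomputable def iUnion [Nonempty ι] (c : ι → Curve M) : Curve M where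
  domain := ⋃ i, (c i).domain
  isConnected := ⟨⟨0, mem_iUnion_of_mem (Classical.arbitrary ι) (c _).zero_mem⟩,
    isPreconnected_iUnion ⟨0, mem_iInter.2 fun i => (c i).zero_mem⟩
      fun i => (c i).isConnected.isPreconnected⟩
  zero_mem := mem_iUnion_of_mem (Classical.arbitrary ι) (c _).zero_mem
  toFun t := (c (mem_iUnion.1 t.2).choose).extend t

theorem extend_iUnion [Nonempty ι] {c : ι → Curve M}
    (hc : ∀ i j, EqOn (c i).extend (c j).extend ((c i).domain ∩ (c j).domain)) (i : ι) :
    EqOn (iUnion c).extend (c i).extend (c i).domain := fun t ht => by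
  have htU : t ∈ ⋃ i, (c i).domain := mem_iUnion_of_mem i ht
  exact ((iUnion c).extend_coe ⟨t, htU⟩).trans
    (hc _ i ⟨(mem_iUnion.1 htU).choose_spec, ht⟩)

end Curve

theorem HasVelocityOn.iUnion {ι : Type*} {I : ι → Set ℝ} (h : ∀ i, HasVelocityOn v γ (I i))
    (hI : ∀ i, (I i).OrdConnected) (ht₀ : ∀ i, t₀ ∈ I i) : HasVelocityOn v γ (⋃ i, I i) := by
  intro t ht
  obtain ⟨i, hti, hi⟩ := exists_mem_nhdsWithin_iUnion_inter_Ici hI ht₀ ht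
  obtain ⟨j, htj, hj⟩ := exists_mem_nhdsWithin_iUnion_inter_Iic hI ht₀ ht
  have hside := ((h i t hti).mono_of_mem_nhdsWithin hi).union
    ((h j t htj).mono_of_mem_nhdsWithin hj)
  rwa [← inter_union_distrib_left, Ici_union_Iic, inter_univ] at hside

theorem HasVelocityOn.isSmoothMap {c : Curve M} (h : HasVelocityOn v c.extend c.domain)
    (hsub : IsSubcartesian F) :
    IsSmoothMap (subspaceStructure (smoothFunctions ℝ) c.domain) F c.toFun := by
  intro f hf
  rw [(isDifferentialStructure_smoothFunctions ℝ).subspaceStructure_eq]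
  intro t
  obtain ⟨g, hg, hfg⟩ := h.exists_contDiff_eventuallyEq hsub c.ordConnected t.2 hf
  refine ⟨g, hg, ?_⟩
  filter_upwards [(eventually_nhds_subtype_iff c.domain t _).2 hfg] with s hs
  rwa [Function.comp_apply, c.extend_coe] at hs

theorem isIntegralCurve_iff_hasVelocityOn (hsub : IsSubcartesian F) {c : Curve M} :
    IsIntegralCurve v c ↔ HasVelocityOn v c.extend c.domain := by
  have hderiv : (∀ f : hF.subalgebra,
      IsDerivOn c.domain ((f : M → ℝ) ∘ c.toFun) ((v f : M → ℝ) ∘ c.toFun)) ↔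
        HasVelocityOn v c.extend c.domain := by
    simp only [Curve.isDerivOn_iff_hasDerivWithinAt]
    exact ⟨fun h t ht f => h f t ht, fun h f t ht => h t ht f⟩
  refine ⟨?_, fun h => .inr ⟨h.isSmoothMap hsub, hderiv.2 h⟩⟩
  rintro (hpoint | ⟨-, h⟩)
  · rw [hpoint]
    exact fun t _ f => HasFDerivWithinAt.of_subsingleton subsingleton_singleton
  · exact hderiv.1 h

theorem exists_isMaximalIntegralCurve (hsub : IsSubcartesian F)
    (v : Derivation ℝ hF.subalgebra hF.subalgebra) (p : M) :
    ∃ c : Curve M, IsMaximalIntegralCurve v c ∧ c.start = p := by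
  let C := {c : Curve M // IsIntegralCurve v c ∧ c.start = p}
  let c : C → Curve M := Subtype.val
  have hv : ∀ i, HasVelocityOn v (c i).extend (c i).domain := fun i =>
    (isIntegralCurve_iff_hasVelocityOn hsub).1 i.2.1
  have hstart : ∀ i, (c i).extend 0 = p := fun i => ((c i).extend_coe ⟨0, _⟩).trans i.2.2
  have hagree : ∀ i j, EqOn (c i).extend (c j).extend ((c i).domain ∩ (c j).domain) :=
    fun i j => ((hv i).mono inter_subset_left).eqOn ((hv j).mono inter_subset_right) hsub
      ((c i).ordConnected.inter (c j).ordConnected) ⟨(c i).zero_mem, (c j).zero_mem⟩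
      ((hstart i).trans (hstart j).symm)
  let point : C := ⟨.point p, .inl rfl, rfl⟩
  have : Nonempty C := ⟨point⟩
  let m : Curve M := .iUnion c
  have hm : ∀ i, EqOn m.extend (c i).extend (c i).domain := Curve.extend_iUnion hagree
  have hm₀ : m.start = p :=
    (m.extend_coe _).symm.trans ((hm point (c point).zero_mem).trans (hstart point))
  have hmv : HasVelocityOn v m.extend m.domain :=
    .iUnion (fun i => (hv i).congr (hm i)) (fun i => (c i).ordConnected) fun i => (c i).zero_mem
  refine ⟨m, ⟨(isIntegralCurve_iff_hasVelocityOn hsub).2 hmv, fun τ hτ hτm => ?_⟩, hm₀⟩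
  let i : C := ⟨τ, hτ, hτm.trans hm₀⟩
  have hdom : τ.domain ⊆ m.domain := subset_iUnion (fun i => (c i).domain) i
  refine ⟨hdom, fun t => ?_⟩
  calc m.toFun (inclusion hdom t) = m.extend t := (m.extend_coe _).symm
    _ = τ.extend t := hm i t.2
    _ = τ.toFun t := τ.extend_coe t

theorem IsMaximalIntegralCurve.eq_of_start_eq {c d : Curve M} (hc : IsMaximalIntegralCurve v c)
    (hd : IsMaximalIntegralCurve v d) (h : c.start = d.start) : c = d := by
  obtain ⟨hdc, heq⟩ := hc.2 d hd.1 h.symm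
  obtain ⟨hcd, -⟩ := hd.2 c hc.1 h
  obtain ⟨J, _, _, γ⟩ := c
  obtain ⟨K, _, _, τ⟩ := d
  obtain rfl : J = K := hcd.antisymm hdc
  congr 1
  exact funext heq

end IntegralCurve

end DiffSpace

theorem corollary3p17_general {M : Type*} [TopologicalSpace M] {F : Set (M → ℝ)}
    {hF : DiffSpace.IsDifferentialStructure F} (hsub : DiffSpace.IsSubcartesian F)
    (v : Derivation ℝ hF.subalgebra hF.subalgebra) (p : M) :
    ∃! c : DiffSpace.Curve M, DiffSpace.IsMaximalIntegralCurve v c ∧ c.start = p := by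
  obtain ⟨c, hc, hcp⟩ := DiffSpace.exists_isMaximalIntegralCurve hsub v p
  exact ⟨c, ⟨hc, hcp⟩, fun d hd => hd.1.eq_of_start_eq hc (hd.2.trans hcp.symm)⟩

theorem corollary3p17 {M : Type*} [TopologicalSpace M] [SecondCountableTopology M]
    {F : Set (M → ℝ)} (hF : DiffSpace.IsDifferentialStructure F)
    (hsub : DiffSpace.IsSubcartesian F) (hdim : DiffSpace.structuralDim F < ⊤)
    (v : Derivation ℝ hF.subalgebra hF.subalgebra) (p : M) :
    ∃! c : DiffSpace.Curve M, DiffSpace.IsMaximalIntegralCurve v c ∧ c.start = p :=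
  corollary3p17_general hsub v p
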